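/- Let $K$ be a field, let $a,b$ be positive integers, let $$R=K[x,y,z,w]/(x^az-y^2,\;x^aw^b-yz,\;w^by-z^2),\qquad \mathfrak m=(x,y,z,w)R .$$ Then $\mathfrak m$ is a maximal ideal of $R$ and the following hold. (1) $R$ and $R_{\mathfrak m}$ are two-dimensional Cohen--Macaulay rings, and $\mathfrak m^2=(x,w)\mathfrak m\subseteq (x,w)R$. Moreover $x,w$ is a system of parameters of $R_{\mathfrak m}$, and $(x,w)R_{\mathfrak m}$ is a parameter ideal, i.e. it is generated by as many elements as its height. (2) If at least one of $a,b$ is not divisible by $3$, then $R$ and $R_{\mathfrak m}$ are integral domains, and $R_{\mathfrak m}$ is analytically unramified (its $\mathfrak m R_{\mathfrak m}$-adic completion is reduced). (3) If $a,b\ge 3$, then the conductor of $R_{\mathfrak m}$ is contained in $(x,w)R_{\mathfrak m}$. Here the conductor of a ring $A$ with total ring of fractions $Q$ and integral closure $\overline A$ in $Q$ is $(A:_Q\overline A)$. If moreover $K$ has characteristic $p>0$, then the parameter test ideal of $R_{\mathfrak m}$ is contained in $(x,w)R_{\mathfrak m}$. Here the parameter test ideal of a ring $A$ of characteristic $p$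 is the ideal of all $c\in A$ with $cJ^*\subseteq J$ for every parameter ideal $J$ of $A$, where $z\in J^*$ (the tight closure of $J$) means that there is $c'\in A$, in no minimal prime of $A$, with $c'z^{p^e}\in J^{[p^e]}$ for all sufficiently large $e$, and $J^{[q]}$ is the ideal generated by the $q$-th powers of the elements of $J$. (4) Consequently the question of Huneke and Swanson has a negative answer: it is not true that, for every analytically unramified Cohen--Macaulay local domain, the conductor is contained in no ideal generated by a system of parameters. Likewise, if $K$ has characteristic $p>0$, it is not true that, for every analytically unramified Cohen--Macaulay local domain of characteristic $p$, the parameter test ideal is contained in no ideal generated by a system of parameters. -/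

import Mathlib

namespace ParameterConductor

section CommutativeAlgebra

variable (A : Type*) [CommRing A]

/-- A Cohen--Macaulay local ring: a Noetherian local ring which has a regular sequence inside the
maximal ideal whose length is the Krull dimension. -/
def IsCohenMacaulayLocal [IsLocalRing A] : Prop :=
  IsNoetherianRing A ∧
    ∃ rs : List A, (∀ r ∈ rs, r ∈ IsLocalRing.maximalIdeal A) ∧
      RingTheory.Sequence.IsRegular A rs ∧ (rs.length : WithBot ℕ∞) = ringKrullDim A

/-- A Cohen--Macaulay ring: a Noetherian ring all of whose localizations at maximal ideals are
Cohen--Macaulay local rings. -/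
def IsCohenMacaulay : Prop :=
  IsNoetherianRing A ∧
    ∀ (p : Ideal A) [p.IsMaximal], IsCohenMacaulayLocal (Localization.AtPrime p)

/-- A Noetherian local ring is analytically unramified if its completion is reduced. -/
def IsAnalyticallyUnramified [IsLocalRing A] : Prop :=
  IsNoetherianRing A ∧ IsReduced (AdicCompletion (IsLocalRing.maximalIdeal A) A)

/-- The conductor `(A :_Q Ā)`, where `Q` is the total ring of fractions of `A` and `Ā` is the
integral closure of `A` in `Q`. It lies in `A`, and is regarded as an ideal of `A`. -/
noncomputable def conductorIdeal : Ideal A :=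
  ((1 : Submodule A (FractionRing A)) /
      Subalgebra.toSubmodule (integralClosure A (FractionRing A))).comap
    (Algebra.linearMap A (FractionRing A))

variable {A}

/-- `f` is a system of parameters of the local ring `A`: the length `d` of `f` is the dimension
of `A`, and the ideal generated by `f` is primary to the maximal ideal. -/
def IsSystemOfParameters [IsLocalRing A] {d : ℕ} (f : Fin d → A) : Prop :=
  ringKrullDim A = d ∧ (Ideal.span (Set.range f)).radical = IsLocalRing.maximalIdeal A

/-- A parameter ideal is an ideal `J` generated by `ht J` elements. -/
def IsParameterIdeal (J : Ideal A) : Prop :=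
  ∃ n : ℕ, J.height = n ∧ ∃ f : Fin n → A, Ideal.span (Set.range f) = J

/-- The ideal `I^[q]` generated by the `q`-th powers of the elements of `I`. -/
def bracketPower (I : Ideal A) (q : ℕ) : Ideal A :=
  Ideal.span ((fun z : A => z ^ q) '' (I : Set A))

/-- The tight closure of the ideal `I`, for a ring `A` of prime characteristic `p`. -/
def tightClosure (p : ℕ) (I : Ideal A) : Set A :=
  {z | ∃ c : A, (∀ P ∈ minimalPrimes A, c ∉ P) ∧
    ∃ N : ℕ, ∀ e : ℕ, N ≤ e → c * z ^ p ^ e ∈ bracketPower I (p ^ e)}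

variable (A)

/-- The parameter test ideal, for a ring `A` of prime characteristic `p`: the elements `c` with
`c J^* ⊆ J` for every parameter ideal `J`. -/
def parameterTestIdeal (p : ℕ) : Ideal A where
  carrier := {c | ∀ J : Ideal A, IsParameterIdeal J → ∀ z ∈ tightClosure p J, c * z ∈ J}
  add_mem' := by
    intro c d hc hd J hJ z hz
    rw [add_mul]
    exact J.add_mem (hc J hJ z hz) (hd J hJ z hz)
  zero_mem' := by
    intro J _ z _
    rw [zero_mul]
    exact J.zero_mem
  smul_mem' := by
    intro r c hc J hJ z hz
    rw [smul_eq_mul, mul_assoc]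
    exact J.mul_mem_left r (hc J hJ z hz)

end CommutativeAlgebra

/-- The assertion asked for by Huneke and Swanson: in an analytically unramified Cohen--Macaulay
local domain, the conductor is not contained in any ideal generated by a system of parameters. -/
def HunekeSwansonAssertion.{u} : Prop :=
  ∀ (A : Type u) [CommRing A] [IsDomain A] [IsLocalRing A],
    IsCohenMacaulayLocal A → IsAnalyticallyUnramified A →
      ∀ (d : ℕ) (f : Fin d → A), IsSystemOfParameters f →
        ¬ conductorIdeal A ≤ Ideal.span (Set.range f)

/-- The analogous assertion for the parameter test ideal, in characteristic `p`. -/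
def ParameterTestAssertion.{u} (p : ℕ) : Prop :=
  ∀ (A : Type u) [CommRing A] [IsDomain A] [IsLocalRing A] [CharP A p],
    IsCohenMacaulayLocal A → IsAnalyticallyUnramified A →
      ∀ (d : ℕ) (f : Fin d → A), IsSystemOfParameters f →
        ¬ parameterTestIdeal A p ≤ Ideal.span (Set.range f)

section Ring

open MvPolynomial

variable (K : Type*) [Field K] (a b : ℕ)

/-- The ideal `(x^a z - y^2, x^a w^b - y z, w^b y - z^2)` of `K[x,y,z,w]`, where the variables
`x, y, z, w` are `X 0, X 1, X 2, X 3`. -/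
noncomputable def relations : Ideal (MvPolynomial (Fin 4) K) :=
  Ideal.span {X 0 ^ a * X 2 - X 1 ^ 2, X 0 ^ a * X 3 ^ b - X 1 * X 2, X 3 ^ b * X 1 - X 2 ^ 2}

/-- The ring `R = K[x,y,z,w]/(x^a z - y^2, x^a w^b - y z, w^b y - z^2)`. -/
abbrev R : Type _ := MvPolynomial (Fin 4) K ⧸ relations K a b

/-- The images of the variables `x, y, z, w` in `R`. -/
noncomputable def coord (i : Fin 4) : R K a b := Ideal.Quotient.mk (relations K a b) (X i)

/-- The ideal `𝔪 = (x, y, z, w) R`. -/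
noncomputable def m : Ideal (R K a b) :=
  Ideal.span {coord K a b 0, coord K a b 1, coord K a b 2, coord K a b 3}

/-- Evaluation at the origin. -/
noncomputable def evalZero [NeZero a] [NeZero b] : R K a b →+* K :=
  Ideal.Quotient.lift (relations K a b) (constantCoeff (σ := Fin 4) (R := K)) (by
    have h : relations K a b ≤ RingHom.ker (constantCoeff (σ := Fin 4) (R := K)) := by
      rw [relations, Ideal.span_le]
      rintro f (rfl | rfl | rfl) <;>
        simp [RingHom.mem_ker, zero_pow (NeZero.ne a), zero_pow (NeZero.ne b)]
    exact fun f hf => h hf)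

theorem evalZero_mk [NeZero a] [NeZero b] (f : MvPolynomial (Fin 4) K) :
    evalZero K a b (Ideal.Quotient.mk (relations K a b) f) = constantCoeff f :=
  rfl

theorem ker_evalZero [NeZero a] [NeZero b] : RingHom.ker (evalZero K a b) = m K a b := by
  apply le_antisymm
  · intro r hr
    obtain ⟨f, rfl⟩ := Ideal.Quotient.mk_surjective r
    have hf : constantCoeff f = 0 := by
      rwa [RingHom.mem_ker, evalZero_mk] at hr
    have key : ∀ g : MvPolynomial (Fin 4) K,
        Ideal.Quotient.mk (relations K a b) (g - C (constantCoeff g)) ∈ m K a b := by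
      intro g
      induction g using MvPolynomial.induction_on with
      | C c => simp
      | add g h hg hh =>
        have := (m K a b).add_mem hg hh
        rw [← map_add] at this
        convert this using 2
        simp only [map_add]
        ring
      | mul_X g i _ =>
        have hi : coord K a b i ∈ m K a b := by
          apply Ideal.subset_span
          fin_cases i <;> simp
        simpa [coord] using (m K a b).mul_mem_left (Ideal.Quotient.mk (relations K a b) g) hi
    simpa [hf] using key f
  · rw [m, Ideal.span_le]
    rintro r (rfl | rfl | rfl | rfl) <;> simp [RingHom.mem_ker, coord, evalZero_mk]

instance isMaximal_m [NeZero a] [NeZero b] : (m K a b).IsMaximal := by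
  rw [← ker_evalZero K a b]
  apply RingHom.ker_isMaximal_of_surjective
  intro c
  exact ⟨Ideal.Quotient.mk (relations K a b) (C c), by simp [evalZero_mk]⟩

/-- The local ring `R_𝔪`. -/
abbrev Rm [NeZero a] [NeZero b] : Type _ := Localization.AtPrime (m K a b)

/-- The elements `x` and `w` of `R_𝔪`. -/
noncomputable def xw [NeZero a] [NeZero b] : Fin 2 → Rm K a b :=
  ![algebraMap (R K a b) (Rm K a b) (coord K a b 0),
    algebraMap (R K a b) (Rm K a b) (coord K a b 3)]

end Ring

end ParameterConductor

universe u

/-! Everything rests on `R` being free over `K[x,w]` with basis `1, y, z` (`equivModel`): the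
multiplication table given by the relations is already associative, so divisibility by a polynomial
in `x, w` can be tested on three coordinates.

Cohen–Macaulayness: a maximal ideal contains monic polynomials `f(x)` and `g(w)`. By freeness they
form a weakly regular sequence, and the maximal ideal is minimal over them because `R` is integral
over `K[x,w]`; hence every such localization has dimension 2.

Conductor and test ideal: put `s = xw`. If `a, b ≥ 3`, then `s^3` divides both `y^3 = x^(2a) w^b`
and `z^3 = x^a w^(2b)`. So `y/s` and `z/s` are integral, and `y, z` lie in the tight closure of
`(s)`. An element `c` of either ideal thus satisfies `s ∣ c y` and `s ∣ c z`, and comparing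
coordinates forces `c ∈ (x, w)` (`mem_span_of_dvd_mul`).

Domain and completion: formally `x = (sT)^3`, `w = T^3`, with `s` now a variable, embeds `R` in
`K[s][T]` when `a, b` are not both divisible by 3, since the three basis elements then occupy
distinct exponent classes mod 3. The power of `T` records total degree, so the `T`-adic order
controls the `𝔪`-adic filtration up to a linear bound, which makes the completion reduced. -/

namespace ParameterConductor

/-! ### The cubic algebra with basis `1, Y, Z` -/

/-- The free module `A³` with basis `1, Y, Z`, and the commutative multiplication with
`Y² = α Z`, `Y Z = α β`, `Z² = β Y`. -/
@[ext]
structure CubicAlgebra {A : Type*} (α β : A) where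
  /-- The coefficient of `1`. -/
  c0 : A
  /-- The coefficient of `Y`. -/
  c1 : A
  /-- The coefficient of `Z`. -/
  c2 : A

namespace CubicAlgebra

variable {A : Type*} [CommRing A] {α β : A}

instance : Zero (CubicAlgebra α β) := ⟨⟨0, 0, 0⟩⟩
instance : One (CubicAlgebra α β) := ⟨⟨1, 0, 0⟩⟩
instance : Add (CubicAlgebra α β) := ⟨fun u v => ⟨u.c0 + v.c0, u.c1 + v.c1, u.c2 + v.c2⟩⟩
instance : Neg (CubicAlgebra α β) := ⟨fun u => ⟨-u.c0, -u.c1, -u.c2⟩⟩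
instance : Mul (CubicAlgebra α β) :=
  ⟨fun u v => ⟨u.c0 * v.c0 + α * β * (u.c1 * v.c2 + u.c2 * v.c1),
    u.c0 * v.c1 + u.c1 * v.c0 + β * (u.c2 * v.c2),
    u.c0 * v.c2 + u.c2 * v.c0 + α * (u.c1 * v.c1)⟩⟩

@[simp] theorem zero_c0 : (0 : CubicAlgebra α β).c0 = 0 := rfl
@[simp] theorem zero_c1 : (0 : CubicAlgebra α β).c1 = 0 := rfl
@[simp] theorem zero_c2 : (0 : CubicAlgebra α β).c2 = 0 := rfl
@[simp] theorem one_c0 : (1 : CubicAlgebra α β).c0 = 1 := rfl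
@[simp] theorem one_c1 : (1 : CubicAlgebra α β).c1 = 0 := rfl
@[simp] theorem one_c2 : (1 : CubicAlgebra α β).c2 = 0 := rfl
@[simp] theorem add_c0 (u v : CubicAlgebra α β) : (u + v).c0 = u.c0 + v.c0 := rfl
@[simp] theorem add_c1 (u v : CubicAlgebra α β) : (u + v).c1 = u.c1 + v.c1 := rfl
@[simp] theorem add_c2 (u v : CubicAlgebra α β) : (u + v).c2 = u.c2 + v.c2 := rfl
@[simp] theorem neg_c0 (u : CubicAlgebra α β) : (-u).c0 = -u.c0 := rfl
@[simp] theorem neg_c1 (u : CubicAlgebra α β) : (-u).c1 = -u.c1 := rfl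
@[simp] theorem neg_c2 (u : CubicAlgebra α β) : (-u).c2 = -u.c2 := rfl
@[simp] theorem mul_c0 (u v : CubicAlgebra α β) :
    (u * v).c0 = u.c0 * v.c0 + α * β * (u.c1 * v.c2 + u.c2 * v.c1) := rfl
@[simp] theorem mul_c1 (u v : CubicAlgebra α β) :
    (u * v).c1 = u.c0 * v.c1 + u.c1 * v.c0 + β * (u.c2 * v.c2) := rfl
@[simp] theorem mul_c2 (u v : CubicAlgebra α β) :
    (u * v).c2 = u.c0 * v.c2 + u.c2 * v.c0 + α * (u.c1 * v.c1) := rfl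

instance : CommRing (CubicAlgebra α β) where
  add_assoc _ _ _ := by ext <;> simp [add_assoc]
  zero_add _ := by ext <;> simp
  add_zero _ := by ext <;> simp
  add_comm _ _ := by ext <;> simp [add_comm]
  neg_add_cancel _ := by ext <;> simp
  -- Consistency of the table, e.g. `(Y Y) Z = α Z² = αβ Y = Y (Y Z)`; this is what makes `R` free
  -- of rank 3 and not a proper quotient.
  mul_assoc _ _ _ := by ext <;> simp <;> ring
  one_mul _ := by ext <;> simp
  mul_one _ := by ext <;> simp
  zero_mul _ := by ext <;> simp
  mul_zero _ := by ext <;> simp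
  left_distrib _ _ _ := by ext <;> simp <;> ring
  right_distrib _ _ _ := by ext <;> simp <;> ring
  mul_comm _ _ := by ext <;> simp <;> ring
  nsmul := nsmulRec
  zsmul := zsmulRec

instance [Nontrivial A] : Nontrivial (CubicAlgebra α β) :=
  ⟨0, 1, fun h => zero_ne_one (congrArg c0 h)⟩

variable (α β) in
/-- The inclusion of the coefficient ring. -/
def of : A →+* CubicAlgebra α β where
  toFun r := ⟨r, 0, 0⟩
  map_zero' := rfl
  map_one' := rfl
  map_add' _ _ := by ext <;> simp
  map_mul' _ _ := by ext <;> simp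

@[simp] theorem of_c0 (r : A) : (of α β r).c0 = r := rfl
@[simp] theorem of_c1 (r : A) : (of α β r).c1 = 0 := rfl
@[simp] theorem of_c2 (r : A) : (of α β r).c2 = 0 := rfl

@[simp] theorem of_pow_c0 (r : A) (n : ℕ) : (of α β r ^ n).c0 = r ^ n := by
  rw [← map_pow, of_c0]

@[simp] theorem of_pow_c1 (r : A) (n : ℕ) : (of α β r ^ n).c1 = 0 := by
  rw [← map_pow, of_c1]

@[simp] theorem of_pow_c2 (r : A) (n : ℕ) : (of α β r ^ n).c2 = 0 := by
  rw [← map_pow, of_c2]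

variable {B : Type*} [CommRing B]

/-- The ring homomorphism out of `CubicAlgebra α β` determined by its values on the coefficients
and on `Y` and `Z`. -/
def lift (ι : A →+* B) (y z : B) (hy : y ^ 2 = ι α * z) (hyz : y * z = ι α * ι β)
    (hz : z ^ 2 = ι β * y) : CubicAlgebra α β →+* B where
  toFun u := ι u.c0 + ι u.c1 * y + ι u.c2 * z
  map_zero' := by simp
  map_one' := by simp
  map_add' u v := by simp; ring
  map_mul' u v := by
    simp only [mul_c0, mul_c1, mul_c2, map_add, map_mul]
    linear_combination (-(ι u.c1 * ι v.c1)) * hy - (ι u.c1 * ι v.c2 + ι u.c2 * ι v.c1) * hyz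
      - (ι u.c2 * ι v.c2) * hz

theorem of_dvd_iff (r : A) (u : CubicAlgebra α β) :
    of α β r ∣ u ↔ r ∣ u.c0 ∧ r ∣ u.c1 ∧ r ∣ u.c2 := by
  constructor
  · rintro ⟨v, rfl⟩
    simp
  · rintro ⟨⟨a, ha⟩, ⟨b, hb⟩, ⟨c, hc⟩⟩
    exact ⟨⟨a, b, c⟩, by ext <;> simp [*]⟩

theorem of_mul_eq_zero {r : A} (hr : ∀ s, r * s = 0 → s = 0) {u : CubicAlgebra α β}
    (hu : of α β r * u = 0) : u = 0 := by
  have h0 := congrArg c0 hu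
  have h1 := congrArg c1 hu
  have h2 := congrArg c2 hu
  simp only [mul_c0, mul_c1, mul_c2, of_c0, of_c1, of_c2, zero_mul, add_zero, mul_zero, zero_c0,
    zero_c1, zero_c2] at h0 h1 h2
  ext
  exacts [hr _ h0, hr _ h1, hr _ h2]

theorem of_dvd_of_dvd_of_mul {r t : A} (h : ∀ s, r ∣ t * s → r ∣ s) {u : CubicAlgebra α β}
    (hu : of α β r ∣ of α β t * u) : of α β r ∣ u := by
  rw [of_dvd_iff] at hu ⊢
  simp only [mul_c0, mul_c1, mul_c2, of_c0, of_c1, of_c2, zero_mul, add_zero, mul_zero] at hu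
  exact ⟨h _ hu.1, h _ hu.2.1, h _ hu.2.2⟩

end CubicAlgebra

/-! ### Identification of `R` with the cubic algebra over `K[x][w]` -/

section Coordinates

open Polynomial

variable (K : Type*) [Field K] (a b : ℕ)

/-- `CubicAlgebra (x ^ a) (w ^ b)` over `K[x][w]`. -/
abbrev Model : Type _ := CubicAlgebra ((C X : K[X][X]) ^ a) ((X : K[X][X]) ^ b)

theorem coord_one_sq : coord K a b 1 ^ 2 = coord K a b 0 ^ a * coord K a b 2 := by
  refine ((Ideal.Quotient.mk_eq_mk_iff_sub_mem _ _).2 (Ideal.subset_span ?_)).symm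
  simp

theorem coord_one_mul_coord_two :
    coord K a b 1 * coord K a b 2 = coord K a b 0 ^ a * coord K a b 3 ^ b := by
  refine ((Ideal.Quotient.mk_eq_mk_iff_sub_mem _ _).2 (Ideal.subset_span ?_)).symm
  simp

theorem coord_two_sq : coord K a b 2 ^ 2 = coord K a b 3 ^ b * coord K a b 1 := by
  refine ((Ideal.Quotient.mk_eq_mk_iff_sub_mem _ _).2 (Ideal.subset_span ?_)).symm
  simp

/-- The map `K[x][w] → R`. -/
noncomputable def coeffMap : K[X][X] →+* R K a b :=
  eval₂RingHom (eval₂RingHom (algebraMap K (R K a b)) (coord K a b 0)) (coord K a b 3)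

@[simp] theorem coeffMap_C_C (c : K) : coeffMap K a b (C (C c)) = algebraMap K _ c := by
  simp [coeffMap]

@[simp] theorem coeffMap_C_X : coeffMap K a b (C X) = coord K a b 0 := by
  simp [coeffMap]

@[simp] theorem coeffMap_X : coeffMap K a b X = coord K a b 3 := by
  simp [coeffMap]

/-- The map from the model to `R`. -/
noncomputable def ofModel : Model K a b →+* R K a b :=
  CubicAlgebra.lift (coeffMap K a b) (coord K a b 1) (coord K a b 2)
    (by simp [coord_one_sq]) (by simp [coord_one_mul_coord_two]) (by simp [coord_two_sq])

/-- The map from `R` to the model. -/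
noncomputable def toModel : R K a b →+* Model K a b :=
  Ideal.Quotient.lift (relations K a b)
    (MvPolynomial.eval₂Hom ((CubicAlgebra.of _ _).comp (C.comp C))
      ![CubicAlgebra.of _ _ (C X), ⟨0, 1, 0⟩, ⟨0, 0, 1⟩, CubicAlgebra.of _ _ X])
    (by
      have h : relations K a b ≤ RingHom.ker
          (MvPolynomial.eval₂Hom ((CubicAlgebra.of ((C X : K[X][X]) ^ a) (X ^ b)).comp (C.comp C))
            ![CubicAlgebra.of _ _ (C X), ⟨0, 1, 0⟩, ⟨0, 0, 1⟩,
              CubicAlgebra.of _ _ (X : K[X][X])]) := by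
        rw [relations, Ideal.span_le]
        rintro f (rfl | rfl | rfl) <;>
          simp only [SetLike.mem_coe, RingHom.mem_ker, map_sub, map_mul, map_pow, sub_eq_zero,
            MvPolynomial.coe_eval₂Hom, MvPolynomial.eval₂_X, Matrix.cons_val] <;>
          apply CubicAlgebra.ext <;> simp [sq]
      exact fun f hf => h hf)

@[simp] theorem toModel_algebraMap (c : K) :
    toModel K a b (algebraMap K _ c) = CubicAlgebra.of _ _ (C (C c)) :=
  (MvPolynomial.eval₂_C _ _ _)

@[simp] theorem toModel_coord_zero :
    toModel K a b (coord K a b 0) = CubicAlgebra.of _ _ (C X : K[X][X]) :=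
  (MvPolynomial.eval₂_X _ _ _)

@[simp] theorem toModel_coord_one : toModel K a b (coord K a b 1) = ⟨0, 1, 0⟩ :=
  (MvPolynomial.eval₂_X _ _ _)

@[simp] theorem toModel_coord_two : toModel K a b (coord K a b 2) = ⟨0, 0, 1⟩ :=
  (MvPolynomial.eval₂_X _ _ _)

@[simp] theorem toModel_coord_three : toModel K a b (coord K a b 3) = CubicAlgebra.of _ _ X :=
  (MvPolynomial.eval₂_X _ _ _)

@[simp] theorem toModel_coeffMap (f : K[X][X]) :
    toModel K a b (coeffMap K a b f) = CubicAlgebra.of _ _ f := by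
  refine RingHom.congr_fun (f := (toModel K a b).comp (coeffMap K a b)) ?_ f
  ext <;> simp

theorem ofModel_apply (u : Model K a b) : ofModel K a b u =
    coeffMap K a b u.c0 + coeffMap K a b u.c1 * coord K a b 1 +
      coeffMap K a b u.c2 * coord K a b 2 := rfl

/-- `R` is free over `K[x][w]` with basis `1, y, z`. -/
noncomputable def equivModel : R K a b ≃+* Model K a b :=
  RingEquiv.ofRingHom (toModel K a b) (ofModel K a b)
    (by
      ext u <;> simp [ofModel_apply])
    (by
      apply Ideal.Quotient.ringHom_ext
      apply MvPolynomial.ringHom_ext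
      · intro c
        change ofModel K a b (toModel K a b (algebraMap K _ c)) = algebraMap K _ c
        simp [ofModel_apply]
      · intro i
        change ofModel K a b (toModel K a b (coord K a b i)) = coord K a b i
        fin_cases i <;> simp [ofModel_apply])

@[simp] theorem equivModel_apply (r : R K a b) : equivModel K a b r = toModel K a b r := rfl

theorem eq_coeffMap_add (r : R K a b) : r = coeffMap K a b (toModel K a b r).c0 +
    coeffMap K a b (toModel K a b r).c1 * coord K a b 1 +
      coeffMap K a b (toModel K a b r).c2 * coord K a b 2 :=
  ((equivModel K a b).symm_apply_apply r).symm

theorem coeffMap_dvd_iff (f : K[X][X]) (r : R K a b) :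
    coeffMap K a b f ∣ r ↔ f ∣ (toModel K a b r).c0 ∧ f ∣ (toModel K a b r).c1 ∧
      f ∣ (toModel K a b r).c2 := by
  rw [← CubicAlgebra.of_dvd_iff, ← toModel_coeffMap]
  exact (map_dvd_iff (equivModel K a b)).symm

end Coordinates

end ParameterConductor

/-! ### Dimension, Cohen–Macaulayness and the parameters `x, w` -/

namespace ParameterConductor

open Polynomial

theorem isWeaklyRegular_pair {A : Type*} [CommRing A] {u v : A}
    (hu : ∀ r, u * r = 0 → r = 0) (hv : ∀ r, u ∣ v * r → u ∣ r) :
    RingTheory.Sequence.IsWeaklyRegular A [u, v] := by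
  rw [RingTheory.Sequence.isWeaklyRegular_cons_iff, RingTheory.Sequence.isWeaklyRegular_singleton_iff]
  refine ⟨isSMulRegular_iff_right_eq_zero_of_smul.2 hu,
    (isSMulRegular_quotient_iff_mem_of_smul_mem _ _).2 fun r hr => ?_⟩
  rw [Submodule.mem_smul_pointwise_iff_exists] at hr ⊢
  obtain ⟨s, -, hs⟩ := hr
  obtain ⟨t, ht⟩ := hv r ⟨s, hs.symm⟩
  exact ⟨t, trivial, ht.symm⟩

/-- The relations give `y^3 = x^(2a) w^b`, and then `z^2 = w^b y`. -/
theorem isIntegral_of_cubic_relations {K B : Type*} [CommRing K] [CommRing B] [Algebra K B]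
    {a b : ℕ} {x y z w : B} (hx : IsIntegral K x) (hw : IsIntegral K w) (hy : y ^ 2 = x ^ a * z)
    (hyz : y * z = x ^ a * w ^ b) (hz : z ^ 2 = w ^ b * y) :
    IsIntegral K y ∧ IsIntegral K z := by
  have hy' : IsIntegral K y := by
    refine IsIntegral.of_pow (n := 3) (by norm_num) ?_
    have h : y ^ 3 = (x ^ a) ^ 2 * w ^ b := by linear_combination y * hy + x ^ a * hyz
    rw [h]
    exact ((hx.pow a).pow 2).mul (hw.pow b)
  refine ⟨hy', IsIntegral.of_pow (n := 2) (by norm_num) ?_⟩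
  rw [hz]
  exact (hw.pow b).mul hy'

theorem isMaximal_of_isIntegral {K A : Type*} [Field K] [CommRing A] [Algebra K A] {S : Set A}
    (hS : Algebra.adjoin K S = ⊤) {q : Ideal A} [q.IsPrime]
    (h : ∀ s ∈ S, IsIntegral K (Ideal.Quotient.mkₐ K q s)) : q.IsMaximal := by
  have htop : Algebra.adjoin K (Ideal.Quotient.mkₐ K q '' S) = ⊤ := by
    rw [← AlgHom.map_adjoin, hS, Algebra.map_top]
    exact (AlgHom.range_eq_top _).2 Ideal.Quotient.mk_surjective
  have hint : Algebra.IsIntegral K (A ⧸ q) := by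
    refine ⟨fun r => ?_⟩
    have hr : r ∈ Algebra.adjoin K (Ideal.Quotient.mkₐ K q '' S) := htop ▸ Algebra.mem_top
    refine (?_ : Algebra.adjoin K (Ideal.Quotient.mkₐ K q '' S) ≤ integralClosure K (A ⧸ q)) hr
    refine Algebra.adjoin_le ?_
    rintro _ ⟨s, hs, rfl⟩
    exact h s hs
  exact Ideal.Quotient.maximal_of_isField _
    (isField_of_isIntegral_of_isField' (Field.toIsField K))

theorem isIntegral_quotient_iff {K A : Type*} [Field K] [CommRing A] [Algebra K A] {q : Ideal A}
    {r : A} : IsIntegral K (Ideal.Quotient.mkₐ K q r) ↔ ∃ f : K[X], f.Monic ∧ aeval r f ∈ q := by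
  refine exists_congr fun f => and_congr_right fun _ => ?_
  rw [← aeval_def, aeval_algHom_apply]
  exact Ideal.Quotient.eq_zero_iff_mem

theorem exists_monic_aeval_mem {K A : Type*} [Field K] [CommRing A] [Algebra K A]
    [Algebra.FiniteType K A] (p : Ideal A) [p.IsMaximal] (r : A) :
    ∃ f : K[X], f.Monic ∧ aeval r f ∈ p := by
  let _ := Ideal.Quotient.field p
  have : Module.Finite K (A ⧸ p) := finite_of_finite_type_of_isJacobsonRing _ _
  exact isIntegral_quotient_iff.1 (Algebra.IsIntegral.isIntegral _)

/-- Krull's height theorem bounds the dimension above by 2; the regular sequence, which stays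
regular after localizing at a prime containing it, bounds it below. -/
theorem cohenMacaulayLocal_of_pair {A : Type*} [CommRing A] [IsNoetherianRing A] (p : Ideal A)
    [p.IsPrime] {u v : A} (hreg : RingTheory.Sequence.IsWeaklyRegular A [u, v])
    (hp : p ∈ (Ideal.span {u, v}).minimalPrimes) :
    IsCohenMacaulayLocal (Localization.AtPrime p) ∧
      ringKrullDim (Localization.AtPrime p) = 2 := by
  have hN : IsNoetherianRing (Localization.AtPrime p) :=
    IsLocalization.isNoetherianRing p.primeCompl _ inferInstance
  have hmem : ∀ r ∈ [u, v], r ∈ p := by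
    have hu : u ∈ p := hp.1.2 (Ideal.subset_span (by simp))
    have hv : v ∈ p := hp.1.2 (Ideal.subset_span (by simp))
    simp [hu, hv]
  have hreg' := hreg.isRegular_of_isLocalization_of_mem (Localization.AtPrime p) p hmem
  have hdim : ringKrullDim (Localization.AtPrime p) = 2 := by
    apply le_antisymm
    · rw [IsLocalization.AtPrime.ringKrullDim_eq_height p]
      have h : p.height ≤ 2 :=
        (Ideal.height_le_card_of_mem_minimalPrimes_span (Set.toFinite _) hp).trans
          (by exact_mod_cast (Set.ncard_insert_le _ _).trans (by simp))
      exact WithBot.coe_le_coe.2 h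
    · rw [← ringKrullDim_add_length_eq_ringKrullDim_of_isRegular _ hreg']
      have : Nontrivial (Localization.AtPrime p ⧸ Ideal.ofList
          ([u, v].map (algebraMap A (Localization.AtPrime p)))) := by
        have := hreg'.2
        rw [Ideal.Quotient.nontrivial_iff]
        simpa [eq_comm] using this
      simpa using add_le_add_left (ringKrullDim_nonneg_of_nontrivial (R := _ ⧸ Ideal.ofList
          ([u, v].map (algebraMap A (Localization.AtPrime p))))) 2
  refine ⟨⟨hN, _, ?_, hreg', by rw [hdim]; simp⟩, hdim⟩
  intro r hr
  obtain ⟨s, hs, rfl⟩ := List.mem_map.1 hr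
  exact (IsLocalization.AtPrime.to_map_mem_maximal_iff _ p s).2 (hmem s hs)

theorem ringKrullDim_eq_of_forall_localization {A : Type*} [CommRing A] [Nontrivial A] {d : ℕ}
    (h : ∀ (p : Ideal A) [p.IsMaximal], ringKrullDim (Localization.AtPrime p) = d) :
    ringKrullDim A = d := by
  rw [← Ideal.sup_isMaximal_height_eq_ringKrullDim]
  have h' (p : Ideal A) (hp : p.IsMaximal) : p.height = d := by
    have h2 := h p
    rw [IsLocalization.AtPrime.ringKrullDim_eq_height p] at h2
    exact_mod_cast h2
  obtain ⟨p, hp⟩ := Ideal.exists_maximal A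
  have hsup : (⨆ (p : Ideal A) (_ : p.IsMaximal), p.height) = d :=
    le_antisymm (iSup₂_le fun p hp => (h' p hp).le)
      ((h' p hp).ge.trans (le_iSup₂_of_le p hp le_rfl))
  rw [hsup]
  rfl

/-- The height of an ideal depends only on its radical, here the maximal ideal. -/
theorem IsSystemOfParameters.isParameterIdeal {A : Type*} [CommRing A] [IsLocalRing A] {d : ℕ}
    {f : Fin d → A} (h : IsSystemOfParameters f) : IsParameterIdeal (Ideal.span (Set.range f)) := by
  refine ⟨d, ?_, f, rfl⟩
  obtain ⟨hd, hrad⟩ := h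
  rw [← IsLocalRing.maximalIdeal_height_eq_ringKrullDim] at hd
  rw [Ideal.height_eq_inf_minimalPrimes, ← Ideal.radical_minimalPrimes, hrad,
    ← Ideal.height_eq_inf_minimalPrimes]
  exact_mod_cast hd

/-- If `f` squares to zero and is represented by a Cauchy sequence `g`, then `g N ^ 2 ∈ I ^ N`, so
`g N ∈ I ^ n`; as `g N` also represents `f` modulo `I ^ n`, every component of `f` vanishes. -/
theorem isReduced_adicCompletion {A : Type*} [CommRing A] (I : Ideal A)
    (h : ∀ n, ∃ N, n ≤ N ∧ ∀ r : A, r ^ 2 ∈ I ^ N → r ∈ I ^ n) :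
    IsReduced (AdicCompletion I A) := by
  rw [isReduced_iff_pow_one_lt 2 one_lt_two]
  intro f hf
  apply AdicCompletion.ext_evalₐ
  intro n
  obtain ⟨N, hnN, hN⟩ := h n
  obtain ⟨g, rfl⟩ := AdicCompletion.mk_surjective I A f
  have h2 := congrArg (AdicCompletion.evalₐ I N) hf
  rw [map_pow, map_zero, AdicCompletion.evalₐ_mk, ← map_pow, Ideal.Quotient.eq_zero_iff_mem] at h2
  rw [map_zero, AdicCompletion.evalₐ_mk, ← AdicCompletion.Ideal.mk_eq_mk I hnN,
    Ideal.Quotient.eq_zero_iff_mem]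
  exact hN _ h2
-- Modulo `f` the polynomial `g` stays monic, hence a nonzerodivisor.
theorem C_dvd_of_C_dvd_map_C_mul {A : Type*} [CommRing A] {f : A} {g s : A[X]} (hg : g.Monic)
    (h : C f ∣ g * s) : C f ∣ s := by
  have key (q : A[X]) : C f ∣ q ↔ q.map (Ideal.Quotient.mk (Ideal.span {f})) = 0 := by
    simp [C_dvd_iff_dvd_coeff, Polynomial.ext_iff, Ideal.Quotient.eq_zero_iff_mem,
      Ideal.mem_span_singleton]
  rw [key, Polynomial.map_mul] at h
  rw [key]
  exact (hg.map _).mul_right_eq_zero_iff.1 h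

variable (K : Type*) [Field K] (a b : ℕ)

theorem coeffMap_C (f : K[X]) : coeffMap K a b (C f) = aeval (coord K a b 0) f := by
  simp [coeffMap, aeval_def]

theorem coeffMap_map_C (g : K[X]) : coeffMap K a b (g.map C) = aeval (coord K a b 3) g := by
  simp only [coeffMap, coe_eval₂RingHom, eval₂_map, aeval_def]
  congr 1
  ext
  simp

theorem eq_zero_of_coeffMap_mul_eq_zero {f : K[X][X]} (hf : f ≠ 0) {r : R K a b}
    (h : coeffMap K a b f * r = 0) : r = 0 := by
  apply (equivModel K a b).injective
  rw [map_zero]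
  apply CubicAlgebra.of_mul_eq_zero (r := f) fun s hs => (mul_eq_zero.1 hs).resolve_left hf
  simpa using congrArg (toModel K a b) h

theorem coeffMap_dvd_of_dvd_mul {f g : K[X][X]} (hfg : ∀ s, f ∣ g * s → f ∣ s) {r : R K a b}
    (h : coeffMap K a b f ∣ coeffMap K a b g * r) : coeffMap K a b f ∣ r := by
  rw [← map_dvd_iff (equivModel K a b)] at h ⊢
  simp only [map_mul, equivModel_apply, toModel_coeffMap] at h ⊢
  exact CubicAlgebra.of_dvd_of_dvd_of_mul hfg h

theorem isWeaklyRegular_aeval {f g : K[X]} (hf : f.Monic) (hg : g.Monic) :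
    RingTheory.Sequence.IsWeaklyRegular (R K a b)
      [aeval (coord K a b 0) f, aeval (coord K a b 3) g] := by
  rw [← coeffMap_C, ← coeffMap_map_C]
  refine isWeaklyRegular_pair (fun r hr => ?_) (fun r hr => ?_)
  · exact eq_zero_of_coeffMap_mul_eq_zero K a b (by simpa using hf.ne_zero) hr
  · exact coeffMap_dvd_of_dvd_mul K a b (fun s hs => C_dvd_of_C_dvd_map_C_mul (hg.map C) hs) hr

theorem adjoin_coord : Algebra.adjoin K (Set.range (coord K a b)) = ⊤ := by
  have h : Set.range (coord K a b) =
      Ideal.Quotient.mkₐ K (relations K a b) '' Set.range MvPolynomial.X := by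
    rw [← Set.range_comp]
    rfl
  rw [h, ← AlgHom.map_adjoin, MvPolynomial.adjoin_range_X, Algebra.map_top]
  exact (AlgHom.range_eq_top _).2 Ideal.Quotient.mk_surjective

/-- Modulo any prime containing `f(x)` and `g(w)`, the generators `x, w`, hence also `y, z`, are
algebraic over `K`; such a prime is already maximal. -/
theorem mem_minimalPrimes_of_isMaximal {p : Ideal (R K a b)} [p.IsMaximal] {f g : K[X]}
    (hf : f.Monic) (hg : g.Monic) (hfp : aeval (coord K a b 0) f ∈ p)
    (hgp : aeval (coord K a b 3) g ∈ p) :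
    p ∈ (Ideal.span {aeval (coord K a b 0) f, aeval (coord K a b 3) g}).minimalPrimes := by
  refine ⟨⟨inferInstance, ?_⟩, fun q ⟨hq, hle⟩ hqp => ?_⟩
  · rw [Ideal.span_le]
    rintro r (rfl | rfl)
    exacts [hfp, hgp]
  · have hx := (isIntegral_quotient_iff (r := coord K a b 0)).2 ⟨f, hf, hle (Ideal.subset_span (by simp))⟩
    have hw := (isIntegral_quotient_iff (r := coord K a b 3)).2 ⟨g, hg, hle (Ideal.subset_span (by simp))⟩
    have hyz := isIntegral_of_cubic_relations hx hw (y := Ideal.Quotient.mkₐ K q (coord K a b 1))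
      (z := Ideal.Quotient.mkₐ K q (coord K a b 2)) (a := a) (b := b)
      (by simp only [← map_pow, ← map_mul, coord_one_sq])
      (by simp only [← map_pow, ← map_mul, coord_one_mul_coord_two])
      (by simp only [← map_pow, ← map_mul, coord_two_sq])
    have : q.IsMaximal := by
      refine isMaximal_of_isIntegral (adjoin_coord K a b) ?_
      rintro _ ⟨i, rfl⟩
      fin_cases i
      exacts [hx, hyz.1, hyz.2, hw]
    exact (this.eq_of_le (Ideal.IsPrime.ne_top inferInstance) hqp).ge

theorem cohenMacaulay_localization (p : Ideal (R K a b)) [p.IsMaximal] :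
    IsCohenMacaulayLocal (Localization.AtPrime p) ∧
      ringKrullDim (Localization.AtPrime p) = 2 := by
  obtain ⟨f, hf, hfp⟩ := exists_monic_aeval_mem (K := K) p (coord K a b 0)
  obtain ⟨g, hg, hgp⟩ := exists_monic_aeval_mem (K := K) p (coord K a b 3)
  exact cohenMacaulayLocal_of_pair p (isWeaklyRegular_aeval K a b hf hg)
    (mem_minimalPrimes_of_isMaximal K a b hf hg hfp hgp)

theorem isCohenMacaulay_R : IsCohenMacaulay (R K a b) :=
  ⟨inferInstance, fun p _ => (cohenMacaulay_localization K a b p).1⟩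

theorem ringKrullDim_R : ringKrullDim (R K a b) = 2 :=
  have : Nontrivial (R K a b) := (equivModel K a b).toEquiv.nontrivial
  ringKrullDim_eq_of_forall_localization fun p _ => (cohenMacaulay_localization K a b p).2

theorem coord_mem_m (i : Fin 4) : coord K a b i ∈ m K a b := by
  apply Ideal.subset_span
  fin_cases i <;> simp

variable [NeZero a] [NeZero b]

theorem m_sq : m K a b ^ 2 = Ideal.span {coord K a b 0, coord K a b 3} * m K a b := by
  have hx : coord K a b 0 ∈ Ideal.span {coord K a b 0, coord K a b 3} :=
    Ideal.subset_span (by simp)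
  have hw : coord K a b 3 ∈ Ideal.span {coord K a b 0, coord K a b 3} :=
    Ideal.subset_span (by simp)
  have hxa : coord K a b 0 ^ a ∈ Ideal.span {coord K a b 0, coord K a b 3} :=
    Ideal.pow_mem_of_mem _ hx _ (NeZero.pos a)
  have hwb : coord K a b 3 ^ b ∈ Ideal.span {coord K a b 0, coord K a b 3} :=
    Ideal.pow_mem_of_mem _ hw _ (NeZero.pos b)
  have hwm : coord K a b 3 ^ b ∈ m K a b :=
    Ideal.pow_mem_of_mem _ (coord_mem_m K a b 3) _ (NeZero.pos b)
  apply le_antisymm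
  · rw [sq, m, Ideal.span_mul_span', Ideal.span_le, ← m]
    rintro _ ⟨u, hu, v, hv, rfl⟩
    have hum : u ∈ m K a b := Ideal.subset_span hu
    have hvm : v ∈ m K a b := Ideal.subset_span hv
    have hyy := coord_one_sq K a b
    have hyz := coord_one_mul_coord_two K a b
    have hzz := coord_two_sq K a b
    rw [sq] at hyy hzz
    change u * v ∈ _
    rcases hu with rfl | rfl | rfl | rfl
    · exact Ideal.mul_mem_mul hx hvm
    · rcases hv with rfl | rfl | rfl | rfl
      · exact mul_comm (coord K a b 0) _ ▸ Ideal.mul_mem_mul hx hum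
      · exact hyy ▸ Ideal.mul_mem_mul hxa (coord_mem_m K a b 2)
      · exact hyz ▸ Ideal.mul_mem_mul hxa hwm
      · exact mul_comm (coord K a b 3) _ ▸ Ideal.mul_mem_mul hw hum
    · rcases hv with rfl | rfl | rfl | rfl
      · exact mul_comm (coord K a b 0) _ ▸ Ideal.mul_mem_mul hx hum
      · rw [mul_comm]
        exact hyz ▸ Ideal.mul_mem_mul hxa hwm
      · exact hzz ▸ Ideal.mul_mem_mul hwb (coord_mem_m K a b 1)
      · exact mul_comm (coord K a b 3) _ ▸ Ideal.mul_mem_mul hw hum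
    · exact Ideal.mul_mem_mul hw hvm
  · rw [sq]
    refine Ideal.mul_mono_left (Ideal.span_le.2 ?_)
    rintro _ (rfl | rfl) <;> exact coord_mem_m K a b _

theorem span_range_xw : Ideal.span (Set.range (xw K a b)) =
    (Ideal.span {coord K a b 0, coord K a b 3}).map (algebraMap (R K a b) (Rm K a b)) := by
  rw [Ideal.map_span, Set.image_pair, xw]
  congr 1
  simp [Matrix.range_cons, Set.pair_comm]

theorem isSystemOfParameters_xw : IsSystemOfParameters (xw K a b) := by
  refine ⟨(cohenMacaulay_localization K a b (m K a b)).2, ?_⟩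
  rw [span_range_xw, ← Localization.AtPrime.map_eq_maximalIdeal]
  apply le_antisymm
  · have : (Ideal.map (algebraMap (R K a b) (Rm K a b)) (m K a b)).IsPrime := by
      rw [Localization.AtPrime.map_eq_maximalIdeal]
      infer_instance
    refine (Ideal.radical_mono (Ideal.map_mono (Ideal.span_le.2 ?_))).trans this.radical.le
    rintro _ (rfl | rfl) <;> exact coord_mem_m K a b _
  · refine fun r hr => ⟨2, ?_⟩
    have h := Ideal.pow_mem_pow hr 2
    rw [← Ideal.map_pow, m_sq] at h
    exact Ideal.map_mono Ideal.mul_le_left h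

end ParameterConductor

/-! ### The conductor and the parameter test ideal -/

namespace ParameterConductor

open Polynomial nonZeroDivisors

/-- The fraction `y/s` is integral, being an `n`-th root of `t`, so `c` multiplies it into `A`. -/
theorem dvd_mul_of_mem_conductorIdeal {A : Type*} [CommRing A] {s t y c : A} (hs : s ∈ A⁰) {n : ℕ}
    (hn : 0 < n) (hy : y ^ n = s ^ n * t) (hc : c ∈ conductorIdeal A) : s ∣ c * y := by
  set η : FractionRing A := IsLocalization.mk' (FractionRing A) y ⟨s, hs⟩ with hη
  have hηs : η * algebraMap A (FractionRing A) s = algebraMap A (FractionRing A) y :=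
    IsLocalization.mk'_spec _ _ _
  have hsu : IsUnit (algebraMap A (FractionRing A) s) :=
    IsLocalization.map_units (FractionRing A) (⟨s, hs⟩ : A⁰)
  have hint : IsIntegral A η := by
    refine IsIntegral.of_pow hn ?_
    have : η ^ n = algebraMap A (FractionRing A) t := by
      apply (hsu.pow n).mul_right_cancel
      rw [← mul_pow, hηs, ← map_pow, hy, map_mul, map_pow, mul_comm]
    rw [this]
    exact isIntegral_algebraMap
  obtain ⟨d, hd⟩ := Submodule.mem_one.1 (Submodule.mem_div_iff_forall_mul_mem.1 hc η hint)
  refine ⟨d, IsFractionRing.injective A (FractionRing A) ?_⟩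
  rw [map_mul, map_mul, hd, ← hηs, Algebra.linearMap_apply]
  ring

/-- The fixed multiplier `s ^ n` absorbs the remainder when `q` is divided by `n`; being a
nonzerodivisor, it avoids every minimal prime. -/
theorem mem_tightClosure_span_singleton {A : Type*} [CommRing A] {s t y : A} (hs : s ∈ A⁰) {n : ℕ}
    (hn : 0 < n) (hy : y ^ n = s ^ n * t) (p : ℕ) : y ∈ tightClosure p (Ideal.span {s}) := by
  refine ⟨s ^ n, fun P hP hmem =>
    notMem_nonZeroDivisors_of_mem_mem_minimalPrimes hmem hP (pow_mem hs n), 0, fun e _ => ?_⟩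
  set q := p ^ e
  have hmem : s ^ q ∈ bracketPower (Ideal.span {s}) q :=
    Ideal.subset_span ⟨s, Ideal.mem_span_singleton_self s, rfl⟩
  -- `y ^ q` supplies `s` to the power `n * (q / n)`, and the multiplier supplies `n` more.
  have hle : q ≤ n * (q / n) + n := by
    have := Nat.div_add_mod q n
    have := Nat.mod_lt q hn
    omega
  obtain ⟨k, hk⟩ := Nat.exists_eq_add_of_le hle
  have h : s ^ n * y ^ q = (s ^ k * t ^ (q / n) * y ^ (q % n)) * s ^ q := by
    calc s ^ n * y ^ q = s ^ n * ((y ^ n) ^ (q / n) * y ^ (q % n)) := by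
          rw [← pow_mul, ← pow_add, Nat.div_add_mod]
      _ = s ^ (n * (q / n) + n) * t ^ (q / n) * y ^ (q % n) := by rw [hy]; ring
      _ = _ := by rw [hk]; ring
  rw [h]
  exact Ideal.mul_mem_left _ _ hmem

theorem isParameterIdeal_span_singleton {A : Type*} [CommRing A] [IsNoetherianRing A] {s : A}
    (hs : s ∈ A⁰) (hu : ¬ IsUnit s) : IsParameterIdeal (Ideal.span {s}) :=
  ⟨1, Ideal.height_span_singleton_eq_one_of_mem_nonZeroDivisors hs hu, fun _ => s, by simp⟩

theorem exists_dvd_mul_of_algebraMap_dvd {A : Type*} [CommRing A] (M : Submonoid A) (B : Type*)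
    [CommRing B] [Algebra A B] [IsLocalization M B] {u v : A}
    (h : algebraMap A B v ∣ algebraMap A B u) : ∃ t ∈ M, v ∣ t * u := by
  obtain ⟨d, hd⟩ := h
  obtain ⟨⟨e, s⟩, he⟩ := IsLocalization.surj M d
  have : algebraMap A B (u * s) = algebraMap A B (v * e) := by
    rw [map_mul, map_mul, hd, ← he]
    ring
  obtain ⟨t, ht⟩ := (IsLocalization.eq_iff_exists M B).1 this
  refine ⟨t * s, mul_mem t.2 s.2, t * e, ?_⟩
  linear_combination ht

section Localization

variable {A : Type*} [CommRing A] (q : Ideal A) [q.IsPrime]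

/-- Transfers the coordinate computation in `A` to the localization by clearing denominators. -/
theorem mem_map_localization_of_dvd_mul {I : Ideal A} {s y z : A}
    (h : ∀ u, s ∣ u * y → s ∣ u * z → u ∈ I) {c : Localization.AtPrime q}
    (hy : algebraMap A (Localization.AtPrime q) s ∣ c * algebraMap A (Localization.AtPrime q) y)
    (hz : algebraMap A (Localization.AtPrime q) s ∣ c * algebraMap A (Localization.AtPrime q) z) :
    c ∈ I.map (algebraMap A (Localization.AtPrime q)) := by
  obtain ⟨⟨u, r⟩, hu⟩ := IsLocalization.surj q.primeCompl c
  have key (v : A) (h : algebraMap A (Localization.AtPrime q) s ∣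
      c * algebraMap A (Localization.AtPrime q) v) : ∃ t ∈ q.primeCompl, s ∣ t * (u * v) := by
    apply exists_dvd_mul_of_algebraMap_dvd q.primeCompl (Localization.AtPrime q)
    have h' := h.mul_right (algebraMap A (Localization.AtPrime q) r)
    rw [mul_right_comm] at h'
    simpa only [map_mul, ← hu] using h'
  obtain ⟨t₁, ht₁, h₁⟩ := key y hy
  obtain ⟨t₂, ht₂, h₂⟩ := key z hz
  have hmem : t₁ * t₂ * u ∈ I := by
    apply h
    · convert h₁.mul_left t₂ using 1
      ring
    · convert h₂.mul_left t₁ using 1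
      ring
  have hmem' := Ideal.mem_map_of_mem (algebraMap A (Localization.AtPrime q)) hmem
  rw [map_mul, ← hu] at hmem'
  have hunit {t : A} (ht : t ∈ q.primeCompl) : IsUnit (algebraMap A (Localization.AtPrime q) t) :=
    IsLocalization.map_units (Localization.AtPrime q) (⟨t, ht⟩ : q.primeCompl)
  rwa [Ideal.unit_mul_mem_iff_mem _ (hunit (mul_mem ht₁ ht₂)),
    Ideal.mul_unit_mem_iff_mem _ (hunit r.2)] at hmem'

theorem conductorIdeal_localization_le {I : Ideal A} {s y z t t' : A} (hs : s ∈ A⁰) {n : ℕ}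
    (hn : 0 < n) (hy : y ^ n = s ^ n * t) (hz : z ^ n = s ^ n * t')
    (h : ∀ u, s ∣ u * y → s ∣ u * z → u ∈ I) :
    conductorIdeal (Localization.AtPrime q) ≤ I.map (algebraMap A (Localization.AtPrime q)) := by
  have hs' : algebraMap A (Localization.AtPrime q) s ∈ (Localization.AtPrime q)⁰ :=
    IsLocalization.map_nonZeroDivisors_le q.primeCompl _ (Submonoid.mem_map_of_mem _ hs)
  exact fun c hc => mem_map_localization_of_dvd_mul q h
    (dvd_mul_of_mem_conductorIdeal hs' hn (by rw [← map_pow, hy, map_mul, map_pow]) hc)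
    (dvd_mul_of_mem_conductorIdeal hs' hn (by rw [← map_pow, hz, map_mul, map_pow]) hc)

theorem parameterTestIdeal_localization_le [IsNoetherianRing A] {I : Ideal A} {s y z t t' : A}
    (hs : s ∈ A⁰) (hsq : s ∈ q) {n : ℕ} (hn : 0 < n) (hy : y ^ n = s ^ n * t)
    (hz : z ^ n = s ^ n * t') (h : ∀ u, s ∣ u * y → s ∣ u * z → u ∈ I) (p : ℕ) :
    parameterTestIdeal (Localization.AtPrime q) p ≤
      I.map (algebraMap A (Localization.AtPrime q)) := by
  have hs' : algebraMap A (Localization.AtPrime q) s ∈ (Localization.AtPrime q)⁰ :=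
    IsLocalization.map_nonZeroDivisors_le q.primeCompl _ (Submonoid.mem_map_of_mem _ hs)
  have hN : IsNoetherianRing (Localization.AtPrime q) :=
    IsLocalization.isNoetherianRing q.primeCompl _ inferInstance
  have hu : ¬ IsUnit (algebraMap A (Localization.AtPrime q) s) := by
    rw [IsLocalization.AtPrime.isUnit_to_map_iff (Localization.AtPrime q) q]
    exact fun h => h hsq
  have hJ := isParameterIdeal_span_singleton hs' hu
  exact fun c hc => mem_map_localization_of_dvd_mul q h
    (Ideal.mem_span_singleton.1 (hc _ hJ _ (mem_tightClosure_span_singleton hs' hn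
      (by rw [← map_pow, hy, map_mul, map_pow]) p)))
    (Ideal.mem_span_singleton.1 (hc _ hJ _ (mem_tightClosure_span_singleton hs' hn
      (by rw [← map_pow, hz, map_mul, map_pow]) p)))

end Localization

variable (K : Type*) [Field K] (a b : ℕ)

theorem coord_zero_mul_coord_three :
    coord K a b 0 * coord K a b 3 = coeffMap K a b (C X * X) := by
  simp

theorem prime_C_X : Prime (C X : K[X][X]) :=
  prime_C_iff.2 prime_X

theorem X_dvd_of_X_dvd_C_X_pow_mul {n : ℕ} {s : K[X][X]} (h : X ∣ (C X : K[X][X]) ^ n * s) :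
    X ∣ s := by
  refine (prime_X.dvd_or_dvd h).resolve_left fun h' => ?_
  have := X_dvd_iff.1 (prime_X.dvd_of_dvd_pow h')
  simp at this

theorem C_X_dvd_of_C_X_dvd_X_pow_mul {n : ℕ} {s : K[X][X]} (h : C X ∣ (X : K[X][X]) ^ n * s) :
    C X ∣ s := by
  refine ((prime_C_X K).dvd_or_dvd h).resolve_left fun h' => ?_
  have := (C_dvd_iff_dvd_coeff _ _).1 ((prime_C_X K).dvd_of_dvd_pow h') 1
  rw [coeff_X_one] at this
  exact not_isUnit_X (isUnit_of_dvd_one this)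

theorem mem_span_of_dvd_mul {u : R K a b}
    (hy : coord K a b 0 * coord K a b 3 ∣ u * coord K a b 1)
    (hz : coord K a b 0 * coord K a b 3 ∣ u * coord K a b 2) :
    u ∈ Ideal.span {coord K a b 0, coord K a b 3} := by
  rw [coord_zero_mul_coord_three, coeffMap_dvd_iff] at hy hz
  simp only [map_mul, toModel_coord_one, toModel_coord_two, CubicAlgebra.mul_c0,
    CubicAlgebra.mul_c1, CubicAlgebra.mul_c2, mul_zero, mul_one, zero_add, add_zero] at hy hz
  -- With `u = u0 + u1 y + u2 z`, the `y`- and `z`-coordinates of `u y` are `u0` and `x^a u1`; the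
  -- `y`-coordinate of `u z` is `w^b u2`. Divisibility by `xw` gives `x ∣ u0`, `w ∣ u1` and `x ∣
  -- u2`.
  obtain ⟨-, h0, h1⟩ := hy
  obtain ⟨-, h2, -⟩ := hz
  have h1' := X_dvd_of_X_dvd_C_X_pow_mul K ((dvd_mul_left _ _).trans h1)
  have h2' := C_X_dvd_of_C_X_dvd_X_pow_mul K ((dvd_mul_right _ _).trans h2)
  have key {i : Fin 4} (hi : i = 0 ∨ i = 3) {f g : K[X][X]} (hf : coeffMap K a b f = coord K a b i)
      (h : f ∣ g) : coeffMap K a b g ∈ Ideal.span {coord K a b 0, coord K a b 3} := by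
    refine Ideal.mem_of_dvd _ (map_dvd (coeffMap K a b) h) (hf ▸ Ideal.subset_span ?_)
    rcases hi with rfl | rfl <;> simp
  rw [eq_coeffMap_add K a b u]
  exact add_mem (add_mem (key (.inl rfl) (coeffMap_C_X K a b) ((dvd_mul_right _ _).trans h0))
    (Ideal.mul_mem_right _ _ (key (.inr rfl) (coeffMap_X K a b) h1')))
    (Ideal.mul_mem_right _ _ (key (.inl rfl) (coeffMap_C_X K a b) h2'))

theorem coord_zero_mul_three_mem_nonZeroDivisors :
    coord K a b 0 * coord K a b 3 ∈ (R K a b)⁰ := by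
  rw [mem_nonZeroDivisors_iff_right, coord_zero_mul_coord_three]
  intro r hr
  rw [mul_comm] at hr
  exact eq_zero_of_coeffMap_mul_eq_zero K a b (by simp) hr

theorem coord_one_pow_three (ha : 3 ≤ a) (hb : 3 ≤ b) :
    coord K a b 1 ^ 3 = (coord K a b 0 * coord K a b 3) ^ 3 *
      (coord K a b 0 ^ (2 * a - 3) * coord K a b 3 ^ (b - 3)) := by
  have h : coord K a b 1 ^ 3 = coord K a b 0 ^ (2 * a) * coord K a b 3 ^ b := by
    rw [mul_comm 2 a, pow_mul]
    linear_combination coord K a b 1 * coord_one_sq K a b +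
      coord K a b 0 ^ a * coord_one_mul_coord_two K a b
  rw [h, mul_pow, mul_mul_mul_comm, ← pow_add, ← pow_add]
  congr 2 <;> omega

theorem coord_two_pow_three (ha : 3 ≤ a) (hb : 3 ≤ b) :
    coord K a b 2 ^ 3 = (coord K a b 0 * coord K a b 3) ^ 3 *
      (coord K a b 0 ^ (a - 3) * coord K a b 3 ^ (2 * b - 3)) := by
  have h : coord K a b 2 ^ 3 = coord K a b 0 ^ a * coord K a b 3 ^ (2 * b) := by
    rw [mul_comm 2 b, pow_mul]
    linear_combination coord K a b 2 * coord_two_sq K a b +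
      coord K a b 3 ^ b * coord_one_mul_coord_two K a b
  rw [h, mul_pow, mul_mul_mul_comm, ← pow_add, ← pow_add]
  congr 2 <;> omega

variable [NeZero a] [NeZero b]

theorem conductorIdeal_le (ha : 3 ≤ a) (hb : 3 ≤ b) :
    conductorIdeal (Rm K a b) ≤ Ideal.span (Set.range (xw K a b)) := by
  rw [span_range_xw]
  exact conductorIdeal_localization_le (m K a b)
    (coord_zero_mul_three_mem_nonZeroDivisors K a b) (Nat.succ_pos 2)
    (coord_one_pow_three K a b ha hb) (coord_two_pow_three K a b ha hb)
    (fun _ => mem_span_of_dvd_mul K a b)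

theorem parameterTestIdeal_le (ha : 3 ≤ a) (hb : 3 ≤ b) (p : ℕ) :
    parameterTestIdeal (Rm K a b) p ≤ Ideal.span (Set.range (xw K a b)) := by
  rw [span_range_xw]
  exact parameterTestIdeal_localization_le (m K a b)
    (coord_zero_mul_three_mem_nonZeroDivisors K a b)
    (Ideal.mul_mem_right _ _ (coord_mem_m K a b 0)) (Nat.succ_pos 2)
    (coord_one_pow_three K a b ha hb) (coord_two_pow_three K a b ha hb)
    (fun _ => mem_span_of_dvd_mul K a b) p

end ParameterConductor

/-! ### Embedding in `K[s][T]`: integrality and the completion -/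

namespace ParameterConductor

open Polynomial nonZeroDivisors

section Localization

variable {A : Type*} [CommRing A] (q : Ideal A) [q.IsPrime]

/-- The multiplier `t` appears because `u ^ 2` lies in the extension of `q ^ N` to the localization
only up to a factor outside `q`. -/
theorem isReduced_adicCompletion_localization
    (h : ∀ n, ∃ N, n ≤ N ∧ ∀ t ∉ q, ∀ u, t * u ^ 2 ∈ q ^ N → u ∈ q ^ n) :
    IsReduced (AdicCompletion (IsLocalRing.maximalIdeal (Localization.AtPrime q))
      (Localization.AtPrime q)) := by
  apply isReduced_adicCompletion
  intro n
  obtain ⟨N, hnN, hN⟩ := h n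
  refine ⟨N, hnN, fun r hr => ?_⟩
  obtain ⟨⟨u, s⟩, hu⟩ := IsLocalization.surj q.primeCompl r
  have hs : IsUnit (algebraMap A (Localization.AtPrime q) s) :=
    IsLocalization.map_units (Localization.AtPrime q) s
  rw [← Localization.AtPrime.map_eq_maximalIdeal, ← Ideal.map_pow] at hr ⊢
  rw [← Ideal.mul_unit_mem_iff_mem _ hs, hu]
  rw [← Ideal.mul_unit_mem_iff_mem _ (hs.pow 2), ← mul_pow, hu, ← map_pow,
    IsLocalization.algebraMap_mem_map_algebraMap_iff q.primeCompl] at hr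
  obtain ⟨t, ht, htu⟩ := hr
  exact Ideal.mem_map_of_mem _ (hN t ht u htu)

end Localization

variable (K : Type*) [Field K] (a b : ℕ)

/-- The map `K[x][w] → K[s][T]` with `x ↦ s ^ 3 T ^ 3` and `w ↦ T ^ 3`. -/
noncomputable def cubeMap : K[X][X] →+* K[X][X] :=
  eval₂RingHom (eval₂RingHom (C.comp C) (C X ^ 3 * X ^ 3)) (X ^ 3)

@[simp] theorem cubeMap_C_C (c : K) : cubeMap K (C (C c)) = C (C c) := by
  simp [cubeMap]

@[simp] theorem cubeMap_C_X : cubeMap K (C X) = C X ^ 3 * X ^ 3 := by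
  simp [cubeMap]

@[simp] theorem cubeMap_X : cubeMap K X = X ^ 3 := by
  simp [cubeMap]

/-- The monomial `x^i w^j` goes to `s^(3i) T^(3i+3j)`, so `k = 3i` and `n - k = 3j`. -/
theorem coeff_coeff_cubeMap (f : K[X][X]) (n k : ℕ) : ((cubeMap K f).coeff n).coeff k =
    if 3 ∣ k ∧ 3 ∣ n ∧ k ≤ n then (f.coeff ((n - k) / 3)).coeff (k / 3) else 0 := by
  induction f using Polynomial.induction_on' with
  | add f g hf hg =>
    rw [map_add, coeff_add, coeff_add, hf, hg]
    split_ifs <;> simp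
  | monomial j p =>
    induction p using Polynomial.induction_on' with
    | add f g hf hg =>
      rw [map_add, map_add, coeff_add, coeff_add, hf, hg]
      split_ifs <;> simp
    | monomial i c =>
      have h : cubeMap K (monomial j (monomial i c)) =
          C (monomial (3 * i) c) * X ^ (3 * i + 3 * j) := by
        simp only [← C_mul_X_pow_eq_monomial, map_mul, map_pow, cubeMap_C_C, cubeMap_C_X,
          cubeMap_X]
        ring
      rw [h, coeff_C_mul, coeff_X_pow, mul_ite, mul_one, mul_zero, coeff_monomial]
      split_ifs with h1 h2 h3 h3 <;> simp only [coeff_monomial, coeff_zero] <;>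
        (try split_ifs) <;> first | rfl | omega

/-- The map `R → K[s][T]` with `x ↦ s ^ 3 T ^ 3`, `y ↦ s ^ (2 a) T ^ (2 a + b)`,
`z ↦ s ^ a T ^ (a + 2 b)` and `w ↦ T ^ 3`. -/
noncomputable def monomialMap : R K a b →+* K[X][X] :=
  (CubicAlgebra.lift (cubeMap K) (C (X ^ (2 * a)) * X ^ (2 * a + b)) (C (X ^ a) * X ^ (a + 2 * b))
    (by simp only [map_pow, cubeMap_C_X]; ring)
    (by simp only [map_pow, cubeMap_C_X, cubeMap_X]; ring)
    (by simp only [map_pow, cubeMap_X]; ring)).comp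
    (toModel K a b)

theorem monomialMap_apply (r : R K a b) : monomialMap K a b r =
    cubeMap K (toModel K a b r).c0 +
      cubeMap K (toModel K a b r).c1 * (C (X ^ (2 * a)) * X ^ (2 * a + b)) +
      cubeMap K (toModel K a b r).c2 * (C (X ^ a) * X ^ (a + 2 * b)) := rfl

theorem coeff_coeff_mul_monomial (f : K[X][X]) (p q n k : ℕ) :
    ((f * (C (X ^ p) * X ^ q)).coeff n).coeff k =
      if q ≤ n ∧ p ≤ k then (f.coeff (n - q)).coeff (k - p) else 0 := by
  rw [← mul_assoc, coeff_mul_X_pow', ite_and]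
  split_ifs with h1 h2
  · rw [coeff_mul_C, coeff_mul_X_pow', if_pos h2]
  · rw [coeff_mul_C, coeff_mul_X_pow', if_neg h2]
  · simp

theorem coeff_coeff_monomialMap (r : R K a b) (n k : ℕ) :
    ((monomialMap K a b r).coeff n).coeff k =
      (if 3 ∣ k ∧ 3 ∣ n ∧ k ≤ n then
        ((toModel K a b r).c0.coeff ((n - k) / 3)).coeff (k / 3) else 0) +
      (if 2 * a + b ≤ n ∧ 2 * a ≤ k then
        if 3 ∣ k - 2 * a ∧ 3 ∣ n - (2 * a + b) ∧ k - 2 * a ≤ n - (2 * a + b) then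
          ((toModel K a b r).c1.coeff ((n - (2 * a + b) - (k - 2 * a)) / 3)).coeff
            ((k - 2 * a) / 3) else 0 else 0) +
      (if a + 2 * b ≤ n ∧ a ≤ k then
        if 3 ∣ k - a ∧ 3 ∣ n - (a + 2 * b) ∧ k - a ≤ n - (a + 2 * b) then
          ((toModel K a b r).c2.coeff ((n - (a + 2 * b) - (k - a)) / 3)).coeff
            ((k - a) / 3) else 0 else 0) := by
  simp only [monomialMap_apply, coeff_add, coeff_coeff_mul_monomial, coeff_coeff_cubeMap]

variable {a b}

/-- Subtracting the `s`-exponent from the `T`-exponent, the images of `1, y, z` have exponent pairs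
`(0, 0)`, `(2a, b)`, `(a, 2b)`. These are pairwise distinct mod 3 under `hab`, so no cancellation
occurs and each coefficient can be read off. -/
theorem coeff_monomialMap_c0 (hab : ¬ (3 ∣ a ∧ 3 ∣ b)) (r : R K a b) (i j : ℕ) :
    ((monomialMap K a b r).coeff (3 * i + 3 * j)).coeff (3 * i) =
      ((toModel K a b r).c0.coeff j).coeff i := by
  rw [coeff_coeff_monomialMap, if_pos (by omega), ← ite_and, ← ite_and, if_neg (by omega),
    if_neg (by omega), show (3 * i + 3 * j - 3 * i) / 3 = j by omega,
    show 3 * i / 3 = i by omega, add_zero, add_zero]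

theorem coeff_monomialMap_c1 (hab : ¬ (3 ∣ a ∧ 3 ∣ b)) (r : R K a b) (i j : ℕ) :
    ((monomialMap K a b r).coeff (3 * i + 3 * j + (2 * a + b))).coeff (3 * i + 2 * a) =
      ((toModel K a b r).c1.coeff j).coeff i := by
  rw [coeff_coeff_monomialMap, if_neg (by omega), ← ite_and, ← ite_and, if_pos (by omega),
    if_neg (by omega), show (3 * i + 3 * j + (2 * a + b) - (2 * a + b) -
      (3 * i + 2 * a - 2 * a)) / 3 = j by omega,
    show (3 * i + 2 * a - 2 * a) / 3 = i by omega, zero_add, add_zero]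

theorem coeff_monomialMap_c2 (hab : ¬ (3 ∣ a ∧ 3 ∣ b)) (r : R K a b) (i j : ℕ) :
    ((monomialMap K a b r).coeff (3 * i + 3 * j + (a + 2 * b))).coeff (3 * i + a) =
      ((toModel K a b r).c2.coeff j).coeff i := by
  rw [coeff_coeff_monomialMap, if_neg (by omega), ← ite_and, ← ite_and, if_neg (by omega),
    if_pos (by omega), show (3 * i + 3 * j + (a + 2 * b) - (a + 2 * b) -
      (3 * i + a - a)) / 3 = j by omega,
    show (3 * i + a - a) / 3 = i by omega, zero_add, zero_add]

theorem monomialMap_injective (hab : ¬ (3 ∣ a ∧ 3 ∣ b)) :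
    Function.Injective (monomialMap K a b) := by
  rw [injective_iff_map_eq_zero]
  intro r hr
  apply (equivModel K a b).injective
  rw [map_zero, equivModel_apply]
  ext j i
  · rw [← coeff_monomialMap_c0 K hab, hr]
    simp
  · rw [← coeff_monomialMap_c1 K hab, hr]
    simp
  · rw [← coeff_monomialMap_c2 K hab, hr]
    simp

theorem isDomain_R (hab : ¬ (3 ∣ a ∧ 3 ∣ b)) : IsDomain (R K a b) :=
  (monomialMap_injective K hab).isDomain (monomialMap K a b)

variable (a b) in
theorem coeffMap_mem_m_pow {f : K[X][X]} {n : ℕ}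
    (hf : ∀ i j, i + j < n → (f.coeff j).coeff i = 0) : coeffMap K a b f ∈ m K a b ^ n := by
  rw [f.as_sum_support_C_mul_X_pow, map_sum]
  refine sum_mem fun j _ => ?_
  rw [(f.coeff j).as_sum_support_C_mul_X_pow, map_sum, Finset.sum_mul, map_sum]
  refine sum_mem fun i hi => ?_
  have hle : n ≤ i + j := by
    by_contra! h
    exact mem_support_iff.1 hi (hf i j h)
  refine Ideal.pow_le_pow_right hle ?_
  simp only [map_mul, map_pow, coeffMap_C_C, coeffMap_C_X, coeffMap_X, mul_assoc]
  exact Ideal.mul_mem_left _ _ ((pow_add (m K a b) i j).ge (Ideal.mul_mem_mul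
    (Ideal.pow_mem_pow (coord_mem_m K a b 0) i) (Ideal.pow_mem_pow (coord_mem_m K a b 3) j)))

/-- A term `x^i w^j` of a coordinate contributes `T`-degree `3(i+j)` plus `0`, `2a + b` or `a + 2b`.
If `i + j < n`, this is below the stated exponent in all three cases, so the term is absent. -/
theorem mem_m_pow_of_X_pow_dvd (hab : ¬ (3 ∣ a ∧ 3 ∣ b)) {n : ℕ} {r : R K a b}
    (h : X ^ (3 * n + 2 * a + 2 * b) ∣ monomialMap K a b r) : r ∈ m K a b ^ n := by
  rw [X_pow_dvd_iff] at h
  rw [eq_coeffMap_add K a b r]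
  refine add_mem (add_mem ?_ (Ideal.mul_mem_right _ _ ?_)) (Ideal.mul_mem_right _ _ ?_) <;>
    refine coeffMap_mem_m_pow K a b fun i j hij => ?_
  · rw [← coeff_monomialMap_c0 K hab, h _ (by omega), coeff_zero]
  · rw [← coeff_monomialMap_c1 K hab, h _ (by omega), coeff_zero]
  · rw [← coeff_monomialMap_c2 K hab, h _ (by omega), coeff_zero]

variable (a b) [NeZero a] [NeZero b]

/-- The preimage of the prime `(T)` is proper and contains the four generators of the maximal ideal
`𝔪`. -/
theorem comap_monomialMap_span_X :
    (Ideal.span {(X : K[X][X])}).comap (monomialMap K a b) = m K a b := by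
  have hprime : (Ideal.span {(X : K[X][X])}).IsPrime :=
    (Ideal.span_singleton_prime X_ne_zero).2 prime_X
  refine ((isMaximal_m K a b).eq_of_le (Ideal.IsPrime.ne_top inferInstance) ?_).symm
  have ha := NeZero.pos a
  have hb := NeZero.pos b
  rw [m, Ideal.span_le]
  rintro _ (rfl | rfl | rfl | rfl) <;>
    rw [SetLike.mem_coe, Ideal.mem_comap, Ideal.mem_span_singleton, monomialMap_apply]
  · simp [Dvd.dvd.mul_left]
  · simp only [toModel_coord_one, map_zero, map_one, zero_mul, add_zero, zero_add, one_mul]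
    exact Dvd.dvd.mul_left (dvd_pow_self _ (by omega)) _
  · simp only [toModel_coord_two, map_zero, map_one, zero_mul, zero_add, one_mul]
    exact Dvd.dvd.mul_left (dvd_pow_self _ (by omega)) _
  · simp

theorem X_pow_dvd_monomialMap {n : ℕ} {r : R K a b} (hr : r ∈ m K a b ^ n) :
    X ^ n ∣ monomialMap K a b r := by
  rw [← Ideal.mem_span_singleton, ← Ideal.span_singleton_pow, ← Ideal.mem_comap]
  refine Ideal.le_comap_pow _ _ ?_
  rwa [comap_monomialMap_span_X]

variable {a b}

theorem mem_m_pow_of_mul_sq_mem (hab : ¬ (3 ∣ a ∧ 3 ∣ b)) (n : ℕ) {t : R K a b}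
    (ht : t ∉ m K a b) {u : R K a b}
    (h : t * u ^ 2 ∈ m K a b ^ (2 * (3 * n + 2 * a + 2 * b))) : u ∈ m K a b ^ n := by
  apply mem_m_pow_of_X_pow_dvd K hab
  -- It suffices to bound the `T`-order of the square, which explains the factor 2 in the exponent
  -- of `h`; the image of `t` is prime to `T`, so it can be dropped.
  rw [← UniqueFactorizationMonoid.pow_dvd_pow_iff_dvd two_ne_zero, ← pow_mul, mul_comm _ 2]
  have h' := X_pow_dvd_monomialMap K a b h
  rw [map_mul, map_pow] at h'
  refine prime_X.pow_dvd_of_dvd_mul_left _ ?_ h'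
  rwa [← Ideal.mem_span_singleton, ← Ideal.mem_comap, comap_monomialMap_span_X]

theorem isAnalyticallyUnramified_Rm (hab : ¬ (3 ∣ a ∧ 3 ∣ b)) :
    IsAnalyticallyUnramified (Rm K a b) :=
  ⟨(cohenMacaulay_localization K a b (m K a b)).1.1,
    isReduced_adicCompletion_localization (m K a b) fun n =>
      ⟨2 * (3 * n + 2 * a + 2 * b), by omega, fun _ ht _ h =>
        mem_m_pow_of_mul_sq_mem K hab n ht h⟩⟩

theorem isDomain_Rm (hab : ¬ (3 ∣ a ∧ 3 ∣ b)) : IsDomain (Rm K a b) :=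
  have := isDomain_R K hab
  IsLocalization.isDomain_localization (m K a b).primeCompl_le_nonZeroDivisors

theorem charP_Rm (hab : ¬ (3 ∣ a ∧ 3 ∣ b)) (p : ℕ) [CharP K p] : CharP (Rm K a b) p :=
  have := isDomain_Rm K hab
  charP_of_injective_algebraMap (algebraMap K (Rm K a b)).injective p

end ParameterConductor

theorem mainTheorem5 (K : Type u) [Field K] (a b : ℕ) [NeZero a] [NeZero b] :
    -- `R` and `R_𝔪` are two-dimensional Cohen--Macaulay rings and `𝔪^2 = (x, w) 𝔪 ⊆ (x, w) R`
    (ringKrullDim (ParameterConductor.R K a b) = 2 ∧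
      ParameterConductor.IsCohenMacaulay (ParameterConductor.R K a b) ∧
      ringKrullDim (ParameterConductor.Rm K a b) = 2 ∧
      ParameterConductor.IsCohenMacaulayLocal (ParameterConductor.Rm K a b) ∧
      ParameterConductor.m K a b ^ 2 =
        Ideal.span {ParameterConductor.coord K a b 0, ParameterConductor.coord K a b 3} *
          ParameterConductor.m K a b ∧
      ParameterConductor.m K a b ^ 2 ≤
        Ideal.span {ParameterConductor.coord K a b 0, ParameterConductor.coord K a b 3}) ∧
    -- `x, w` is a system of parameters of `R_𝔪`, and `(x, w) R_𝔪` is a parameter ideal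
    (ParameterConductor.IsSystemOfParameters (ParameterConductor.xw K a b) ∧
      ParameterConductor.IsParameterIdeal
        (Ideal.span (Set.range (ParameterConductor.xw K a b)))) ∧
    -- the domain property
    (¬ (3 ∣ a ∧ 3 ∣ b) →
      IsDomain (ParameterConductor.R K a b) ∧
      IsDomain (ParameterConductor.Rm K a b) ∧
      ParameterConductor.IsAnalyticallyUnramified (ParameterConductor.Rm K a b)) ∧
    -- the conductor and the parameter test ideal
    (3 ≤ a → 3 ≤ b →
      ParameterConductor.conductorIdeal (ParameterConductor.Rm K a b) ≤
        Ideal.span (Set.range (ParameterConductor.xw K a b)) ∧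
      ∀ p : ℕ, p.Prime → CharP K p →
        ParameterConductor.parameterTestIdeal (ParameterConductor.Rm K a b) p ≤
          Ideal.span (Set.range (ParameterConductor.xw K a b))) ∧
    -- the negative answers
    ¬ ParameterConductor.HunekeSwansonAssertion.{u} ∧
    (∀ p : ℕ, p.Prime → CharP K p → ¬ ParameterConductor.ParameterTestAssertion.{u} p) := by
  open ParameterConductor in
  refine ⟨⟨ringKrullDim_R K a b, isCohenMacaulay_R K a b,
    (cohenMacaulay_localization K a b (m K a b)).2,
    (cohenMacaulay_localization K a b (m K a b)).1, m_sq K a b,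
    (m_sq K a b).trans_le Ideal.mul_le_left⟩,
    ⟨isSystemOfParameters_xw K a b, (isSystemOfParameters_xw K a b).isParameterIdeal⟩,
    fun hab => ⟨isDomain_R K hab, isDomain_Rm K hab, isAnalyticallyUnramified_Rm K hab⟩,
    fun ha hb => ⟨conductorIdeal_le K a b ha hb, fun p _ _ => parameterTestIdeal_le K a b ha hb p⟩,
    fun h => ?_, fun p _ hp h => ?_⟩
  -- The choice `a = b = 4` meets both requirements: at least 3, and not both divisible by 3.
  · have := isDomain_Rm K (a := 4) (b := 4) (by decide)
    exact h (Rm K 4 4) (cohenMacaulay_localization K 4 4 (m K 4 4)).1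
      (isAnalyticallyUnramified_Rm K (by decide)) 2 (xw K 4 4) (isSystemOfParameters_xw K 4 4)
      (conductorIdeal_le K 4 4 (by decide) (by decide))
  · have := isDomain_Rm K (a := 4) (b := 4) (by decide)
    have := charP_Rm K (a := 4) (b := 4) (by decide) p
    exact h (Rm K 4 4) (cohenMacaulay_localization K 4 4 (m K 4 4)).1
      (isAnalyticallyUnramified_Rm K (by decide)) 2 (xw K 4 4) (isSystemOfParameters_xw K 4 4)
      (parameterTestIdeal_le K 4 4 (by decide) (by decide) p)
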